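/- Let $X$ be an irreducible smooth affine algebraic surface over $\mathbb{C}$ that is not isomorphic, as an algebraic variety, to $\mathbb{C}^2$, $\mathbb{C}^*\times\mathbb{C}^*$ or $\mathbb{C}^*\times\mathbb{C}$. Let $\mathbb{C}[X]$ be its ring of regular functions. Regard algebraic vector fields on $X$ as $\mathbb{C}$-derivations of $\mathbb{C}[X]$. Such a field is called locally nilpotent if each element of $\mathbb{C}[X]$ is annihilated by some iterate of it (equivalently, if its phase flow is an algebraic action of $\mathbb{C}_+$ on $X$), and semi-simple if its phase flow is induced by an algebraic action of $\mathbb{C}^*$ on $X$, that is, if it is a nonzero constant multiple of the velocity field of such an action. A pair $(\xi,\eta)$ of nonzero completely integrable algebraic vector fields on $X$ is called semi-compatible if the $\mathbb{C}$-linear span of the set of products $\{fg : f,g\in\mathbb{C}[X],\ \xi(f)=0,\ \eta(g)=0\}$ contains a nonzero ideal of $\mathbb{C}[X]$. (Locally nilpotent and semi-simple vector fields are automatically completely integrable.) Then there is no semi-compatible pair $(\xi,\eta)$ of algebraic vector fields on $X$ such that each of $\xi$ and $\eta$ is locally nilpotent or semi-simple. -/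

import Mathlib

open scoped TensorProduct Polynomial LaurentPolynomial

/-! An irreducible affine complex variety `X` is represented by its ring `A = ℂ[X]` of regular
functions; an algebraic vector field on `X` is a `ℂ`-derivation of `A`. -/

/-- `A` is the ring of regular functions on an irreducible smooth affine complex surface. -/
structure IsSmoothAffineSurface (A : Type*) [CommRing A] [Algebra ℂ A] : Prop where
  isDomain : IsDomain A
  smooth : Algebra.Smooth ℂ A
  dim_eq_two : ringKrullDim A = 2

/-- An algebraic vector field on the variety with ring of regular functions `A`. -/
abbrev AlgVectorField (A : Type*) [CommRing A] [Algebra ℂ A] : Type _ := Derivation ℂ A A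

namespace AlgVectorField

variable {A : Type*} [CommRing A] [Algebra ℂ A]

/-- A locally nilpotent vector field: every regular function is killed by some iterate. -/
def IsLocallyNilpotent (ξ : AlgVectorField A) : Prop :=
  ∀ f : A, ∃ n : ℕ, (⇑ξ)^[n] f = 0

/-- A semi-simple vector field: there is an algebraic action of `ℂ*` on `X`, i.e. an action `φ`
by automorphisms of `A` such that for each regular function `f` the function
`(t, x) ↦ (φ t f) x` is regular on `ℂ* × X`, namely `φ t f = ∑ₙ tⁿ pₙ` for a Laurent polynomial
with coefficients `pₙ` in `A`, whose velocity `d/dt|_{t = 1} φ t f = ∑ₙ n pₙ` is `ξ f`, up to a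
nonzero complex factor `c` which is independent of `f` (thus the flow of `ξ` at time `s` is
the action of `exp (c s)`). -/
def IsSemisimple (ξ : AlgVectorField A) : Prop :=
  ∃ (φ : ℂˣ →* (A ≃ₐ[ℂ] A)) (c : ℂ), c ≠ 0 ∧ ∀ f : A, ∃ p : ℤ →₀ A,
    (∀ t : ℂˣ, φ t f = p.sum fun n a => ((t ^ n : ℂˣ) : ℂ) • a) ∧
    ξ f = c • p.sum fun n a => n • a

/-- The complex linear span of `Ker ξ · Ker η`, inside the ring of regular functions. -/
def kerSpan (ξ η : AlgVectorField A) : Submodule ℂ A :=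
  Submodule.span ℂ {h | ∃ f g : A, ξ f = 0 ∧ η g = 0 ∧ h = f * g}

/-- A semi-compatible pair of vector fields: both are nontrivial and the span of `Ker ξ · Ker η`
contains a nonzero ideal. This is used for locally nilpotent and semi-simple fields only, which
are completely integrable automatically. -/
def IsSemiCompatible (ξ η : AlgVectorField A) : Prop :=
  ξ ≠ 0 ∧ η ≠ 0 ∧ ∃ I : Ideal A, I ≠ ⊥ ∧ (I : Set A) ⊆ kerSpan ξ η

end AlgVectorField

/-! Semi-compatibility forces `A` to be the tensor product of the two kernels, and each kernel is
the ring of a line or of a punctured line; the resulting products are exactly the excluded surfaces.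
Let `h ≠ 0` lie in the ideal. If `ξ` killed `Ker η`, it would kill `h * a` for every `a`, hence
vanish; so some `g ∈ Ker η` has `ξ g ≠ 0`, and symmetrically for `η`. Restricting functions to an
orbit of `ξ` on which `g` varies gives a map `A → ℂ[T;T⁻¹]`. It is injective on `Ker η`, since in
dimension two every element of `Ker η` is algebraic over `ℂ[g]`. As `Ker η` is integrally closed,
Lüroth's theorem and a count of units make it `ℂ[X]` or `ℂ[T;T⁻¹]`. A generator of `Ker η` is moved
by `ξ`, hence transcendental over `Ker ξ`, so `Ker ξ ⊗ Ker η → A` is injective. Its image contains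
`h * A`, so `A` is finite and birational over a smooth, hence normal, ring, and the map is onto. -/

namespace Derivation

/-! ### Kernels of derivations -/

variable {k A : Type*} [Field k] [CommRing A] [Algebra k A]

/-- The kernel of a derivation, as a subalgebra. -/
def kerSubalgebra (D : Derivation k A A) : Subalgebra k A where
  carrier := {a | D a = 0}
  mul_mem' {a b} ha hb := by
    change D a = 0 at ha
    change D b = 0 at hb
    simp [ha, hb]
  add_mem' {a b} ha hb := by
    change D a = 0 at ha
    change D b = 0 at hb
    simp [ha, hb]
  algebraMap_mem' r := by simp

@[simp]
lemma mem_kerSubalgebra {D : Derivation k A A} {a : A} : a ∈ D.kerSubalgebra ↔ D a = 0 := Iff.rfl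

/-- A derivation is linear over its kernel. -/
def overKer (D : Derivation k A A) : Derivation D.kerSubalgebra A A :=
  Derivation.mk'
    { toFun := D
      map_add' := D.map_add
      map_smul' := fun c a => by
        have hc : D c.1 = 0 := c.2
        simp [Subalgebra.smul_def, hc] }
    (fun a b => by simp)

@[simp]
lemma overKer_apply (D : Derivation k A A) (a : A) : D.overKer a = D a := rfl

lemma transcendental_kerSubalgebra [IsDomain A] [CharZero k] (D : Derivation k A A) {g : A}
    (hg : D g ≠ 0) : Transcendental D.kerSubalgebra g := by
  have : CharZero A := charZero_of_injective_algebraMap (algebraMap k A).injective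
  have : CharZero D.kerSubalgebra :=
    charZero_of_injective_algebraMap (algebraMap k D.kerSubalgebra).injective
  rw [transcendental_iff]
  intro p
  induction h : p.natDegree using Nat.strong_induction_on generalizing p with
  | _ n ih =>
    intro hp
    -- Over its kernel `D` obeys the chain rule `D (p(g)) = p'(g) * D g`, so a relation for `g`
    -- differentiates to one of lower degree.
    have h1 : Polynomial.aeval g p.derivative = 0 := by
      have := D.overKer.map_aeval p g
      rw [hp, map_zero, overKer_apply, smul_eq_mul] at this
      exact (mul_eq_zero.mp this.symm).resolve_right hg
    have h0 : p.natDegree = 0 := by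
      by_contra hn
      have := ih _ (h ▸ Polynomial.natDegree_derivative_lt hn) p.derivative rfl h1
      exact hn (Polynomial.derivative_eq_zero.mp this)
    rw [Polynomial.eq_C_of_natDegree_eq_zero h0] at hp ⊢
    rw [Polynomial.aeval_C] at hp
    rw [(FaithfulSMul.algebraMap_injective D.kerSubalgebra A) (hp.trans (map_zero _).symm), map_zero]

/-- A fraction `f / g` integral over the kernel already lies in `A`, say as `a`; applying `D` to `a
* g = f` gives `g * D a = 0`. -/
lemma isIntegrallyClosed_kerSubalgebra [IsDomain A] [IsIntegrallyClosed A] (D : Derivation k A A) :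
    IsIntegrallyClosed D.kerSubalgebra := by
  rw [isIntegrallyClosed_iff (FractionRing D.kerSubalgebra)]
  intro x hx
  let φ : FractionRing D.kerSubalgebra →ₐ[D.kerSubalgebra] FractionRing A :=
    IsFractionRing.liftAlgHom (g := Algebra.ofId D.kerSubalgebra (FractionRing A))
      (FaithfulSMul.algebraMap_injective _ _)
  have h1 : IsIntegral A (φ x) := (hx.map φ).tower_top
  obtain ⟨a, ha⟩ := (isIntegrallyClosed_iff (FractionRing A)).mp inferInstance h1
  obtain ⟨f, g, hg, rfl⟩ := IsFractionRing.div_surjective (A := D.kerSubalgebra) x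
  have hg0 : g ≠ 0 := nonZeroDivisors.ne_zero hg
  have hg1 : algebraMap D.kerSubalgebra (FractionRing A) g ≠ 0 :=
    (map_ne_zero_iff _ (FaithfulSMul.algebraMap_injective _ _)).mpr hg0
  have h2 : a * g.1 = f.1 := by
    apply FaithfulSMul.algebraMap_injective A (FractionRing A)
    rw [map_mul, ha, map_div₀, φ.commutes, φ.commutes]
    exact div_mul_cancel₀ _ hg1
  have h3 : D a = 0 := by
    have h4 := congrArg D h2
    rw [leibniz, show D f.1 = 0 from f.2, show D g.1 = 0 from g.2] at h4
    simpa [show g.1 ≠ 0 from fun h => hg0 (Subtype.ext h)] using h4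
  refine ⟨⟨a, h3⟩, φ.toRingHom.injective ?_⟩
  change φ _ = φ _
  rw [φ.commutes, ← ha]
  rfl

end Derivation

/-! ### Smooth domains are normal -/

/-- A domain étale over an integrally closed domain is integrally closed. -/
lemma IsIntegrallyClosed.of_etale (P S : Type*) [CommRing P] [IsDomain P] [IsIntegrallyClosed P]
    [CommRing S] [IsDomain S] [Algebra P S] [Algebra.Etale P S] : IsIntegrallyClosed S := by
  let F := FractionRing P
  have hinj : Function.Injective (algebraMap P S) := FaithfulSMul.algebraMap_injective P S
  have hM : Algebra.algebraMapSubmonoid S (nonZeroDivisors P) ≤ nonZeroDivisors S := by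
    rintro _ ⟨p, hp, rfl⟩
    exact mem_nonZeroDivisors_of_ne_zero
      ((map_ne_zero_iff _ hinj).mpr (nonZeroDivisors.ne_zero hp))
  have hloc : IsLocalization (Algebra.algebraMapSubmonoid S (nonZeroDivisors P)) (S ⊗[P] F) :=
    IsLocalization.tensor _ _
  have hdom : IsDomain (S ⊗[P] F) := IsLocalization.isDomain_of_le_nonZeroDivisors _ hM
  have hdom' : IsDomain (F ⊗[P] S) :=
    (Algebra.TensorProduct.comm P F S).toRingEquiv.toMulEquiv.isDomain _
  -- The generic fibre is a domain finite over the field `F`, hence a field, and it serves as the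
  -- fraction field of `S`.
  have hfin : Module.Finite F (F ⊗[P] S) := Algebra.FormallyUnramified.finite_of_free _ _
  have hfield' : IsField (F ⊗[P] S) :=
    isField_of_isIntegral_of_isField' (Field.toIsField F)
  have hfield : IsField (S ⊗[P] F) :=
    (Algebra.TensorProduct.comm P S F).toRingEquiv.toMulEquiv.isField hfield'
  let := hfield.toField
  have hfrac : IsFractionRing S (S ⊗[P] F) := by
    refine IsFractionRing.of_field S _ fun z => ?_
    obtain ⟨⟨a, b⟩, h⟩ :=
      IsLocalization.surj (Algebra.algebraMapSubmonoid S (nonZeroDivisors P)) z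
    refine ⟨a, b, ?_⟩
    rw [← h, mul_div_cancel_right₀]
    exact (IsLocalization.map_units _ b).ne_zero
  rw [isIntegrallyClosed_iff (S ⊗[P] F)]
  intro x hx
  -- Integral closure commutes with smooth base change, so `x` comes from `S ⊗ integralClosure P F`,
  -- and that closure is `P`.
  obtain ⟨z, hz⟩ := (TensorProduct.toIntegralClosure_bijective_of_smooth (R := P) (S := S)
    (B := F)).2 ⟨x, hx⟩
  have hz' : Algebra.TensorProduct.map (.id S S) (integralClosure P F).val z = x :=
    congrArg Subtype.val hz
  clear hz hx
  subst hz'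
  change _ ∈ (algebraMap S (S ⊗[P] F)).range
  induction z with
  | zero => rw [map_zero]; exact zero_mem _
  | add a b ha hb => rw [map_add]; exact add_mem ha hb
  | tmul s c =>
    obtain ⟨p, hp⟩ := (isIntegrallyClosed_iff F).mp ‹_› c.2
    refine ⟨p • s, ?_⟩
    simp only [Algebra.TensorProduct.map_tmul, AlgHom.coe_id, id_eq, Subalgebra.coe_val, ← hp,
      Algebra.TensorProduct.algebraMap_apply, Algebra.algebraMap_self, RingHom.id_apply]
    rw [TensorProduct.smul_tmul, Algebra.algebraMap_eq_smul_one]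

/-- A domain smooth over a field is integrally closed. -/
lemma IsIntegrallyClosed.of_smooth (k A : Type*) [Field k] [CommRing A] [IsDomain A]
    [Algebra k A] [Algebra.Smooth k A] : IsIntegrallyClosed A := by
  refine IsIntegrallyClosed.of_localization_maximal fun p _ _ => ?_
  obtain ⟨f, hf, n, _, _, _⟩ := Algebra.IsSmoothAt.exists_isStandardEtale_mvPolynomial
    (R := k) (p := p)
  have hfp : Submonoid.powers f ≤ p.primeCompl := Submonoid.powers_le.mpr hf
  have : IsDomain (Localization.Away f) := IsLocalization.isDomain_of_le_nonZeroDivisors _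
    (hfp.trans p.primeCompl_le_nonZeroDivisors)
  have : IsIntegrallyClosed (Localization.Away f) :=
    .of_etale (MvPolynomial (Fin n) k) _
  let := IsLocalization.localizationAlgebraOfSubmonoidLe (Localization.Away f)
    (Localization.AtPrime p) _ _ hfp
  have := IsLocalization.localization_isScalarTower_of_submonoid_le (Localization.Away f)
    (Localization.AtPrime p) _ _ hfp
  have := IsLocalization.isLocalization_of_submonoid_le (Localization.Away f)
    (Localization.AtPrime p) _ _ hfp
  have hle : p.primeCompl.map (algebraMap A (Localization.Away f)) ≤
      nonZeroDivisors (Localization.Away f) := by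
    rintro _ ⟨a, ha, rfl⟩
    refine mem_nonZeroDivisors_of_ne_zero ((map_ne_zero_iff _ (IsLocalization.injective _
      (hfp.trans p.primeCompl_le_nonZeroDivisors))).mpr ?_)
    exact nonZeroDivisors.ne_zero (p.primeCompl_le_nonZeroDivisors ha)
  exact isIntegrallyClosed_of_isLocalization (R := Localization.Away f) _ _ hle

/-! ### Dimension, transcendence degree and closed points -/

/-- Lying over lifts the bottom of a chain of primes, and going up lifts the rest. -/
lemma ringKrullDim_le_of_isIntegral_of_injective (R S : Type*) [CommRing R] [CommRing S]
    [Algebra R S] [Algebra.IsIntegral R S] (h : Function.Injective (algebraMap R S)) :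
    ringKrullDim R ≤ ringKrullDim S := by
  refine iSup_le fun l => ?_
  obtain ⟨Q, hQ, hQl⟩ := Ideal.exists_ideal_over_prime_of_isIntegral l.head.asIdeal (⊥ : Ideal S)
    (by
      rw [← RingHom.ker_eq_comap_bot, (RingHom.injective_iff_ker_eq_bot _).mp h]
      exact bot_le)
  have : Q.LiesOver l.head.asIdeal := ⟨hQl.2.symm⟩
  have : Q.IsPrime := hQl.1
  obtain ⟨L, hL, -, -⟩ := Ideal.exists_ltSeries_of_hasGoingUp l Q
  rw [← hL]
  exact le_iSup (fun p : LTSeries (PrimeSpectrum S) => ((p.length : ℕ∞) : WithBot ℕ∞)) L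

/-- The transcendence degree of a finitely generated domain is at most its Krull dimension. -/
lemma trdeg_le_of_ringKrullDim_le (k A : Type*) [Field k] [CommRing A] [IsDomain A] [Algebra k A]
    [Algebra.FiniteType k A] {n : ℕ} (h : ringKrullDim A ≤ n) : Algebra.trdeg k A ≤ n := by
  -- Noether normalization: `s` is bounded by the dimension, and `A` is algebraic over the images of
  -- the `s` variables.
  obtain ⟨s, g, hg, hfin⟩ := exists_finite_inj_algHom_of_fg k A
  algebraize [g.toRingHom]
  have : Module.Finite (MvPolynomial (Fin s) k) A := hfin
  have : IsScalarTower k (MvPolynomial (Fin s) k) A := .of_algebraMap_eq' g.comp_algebraMap.symm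
  have hs := ringKrullDim_le_of_isIntegral_of_injective (MvPolynomial (Fin s) k) A hg
  rw [MvPolynomial.ringKrullDim_of_isNoetherianRing, ringKrullDim_eq_zero_of_field, zero_add,
    Nat.card_eq_fintype_card, Fintype.card_fin] at hs
  have hsn : s ≤ n := by exact_mod_cast hs.trans h
  have hr : (Algebra.adjoin k (Set.range fun i => g (MvPolynomial.X i)) : Subalgebra k A)
      = g.range := by
    rw [Algebra.adjoin_range_eq_range_aeval]
    congr 1
    ext i
    simp
  have halg : Algebra.IsAlgebraic
      (Algebra.adjoin k (Set.range fun i => g (MvPolynomial.X i)) : Subalgebra k A) A := by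
    rw [hr]
    let := g.rangeRestrict.toRingHom.toAlgebra
    have : IsScalarTower (MvPolynomial (Fin s) k) g.range A := .of_algebraMap_eq' rfl
    have : Algebra.IsIntegral g.range A := .tower_top (MvPolynomial (Fin s) k)
    infer_instance
  have hcard := Cardinal.mk_range_le_lift (f := fun i => g (MvPolynomial.X i))
  rw [Cardinal.lift_uzero, Cardinal.mk_fin, Cardinal.lift_natCast] at hcard
  exact (Algebra.IsAlgebraic.trdeg_le_cardinalMk k _ (alg := halg)).trans
    (hcard.trans (by exact_mod_cast hsn))

/-- On a finitely generated domain of dimension at most two, two functions in the kernel of a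
nonzero derivation are algebraically dependent. -/
lemma Derivation.isAlgebraic_adjoin_of_mem_kerSubalgebra {k A : Type*} [Field k] [CharZero k]
    [CommRing A] [IsDomain A] [Algebra k A] [Algebra.FiniteType k A] (hA : ringKrullDim A ≤ 2)
    {D : Derivation k A A} (hD : D ≠ 0) {f g : A} (hf : D f = 0) (hg : D g = 0)
    (hgt : Transcendental k g) : IsAlgebraic (Algebra.adjoin k {g}) f := by
  by_contra hft
  obtain ⟨h, hh⟩ : ∃ h, D h ≠ 0 := by
    by_contra! H
    exact hD (Derivation.ext H)
  have h1 : AlgebraicIndependent k (fun _ : Unit => g) :=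
    algebraicIndependent_unique_type_iff.mpr hgt
  have h2 : AlgebraicIndependent k (fun o : Option Unit => o.elim f fun _ => g) := by
    rw [h1.option_iff_transcendental, Set.range_const]
    exact hft
  have h3 : AlgebraicIndependent k
      (fun o : Option (Option Unit) => o.elim h fun o => o.elim f fun _ => g) := by
    rw [h2.option_iff_transcendental]
    intro halg
    have hle : Algebra.adjoin k (Set.range fun o : Option Unit => o.elim f fun _ => g)
        ≤ D.kerSubalgebra := by
      refine Algebra.adjoin_le ?_
      rintro _ ⟨_ | _, rfl⟩
      · exact hf
      · exact hg
    let := (Subalgebra.inclusion hle).toRingHom.toAlgebra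
    have : IsScalarTower (Algebra.adjoin k (Set.range fun o : Option Unit => o.elim f fun _ => g))
        D.kerSubalgebra A := .of_algebraMap_eq' rfl
    exact D.transcendental_kerSubalgebra hh
      (halg.extendScalars (Subalgebra.inclusion_injective hle))
  have h4 := h3.lift_cardinalMk_le_trdeg
  have h5 := trdeg_le_of_ringKrullDim_le k A (n := 2) hA
  have h6 := h4.trans (Cardinal.lift_le.mpr h5)
  simp only [Cardinal.mk_fintype, Cardinal.lift_natCast] at h6
  have h7 : Fintype.card (Option (Option Unit)) ≤ 2 := by exact_mod_cast h6
  simp at h7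

/-- Nullstellensatz: a nonzero regular function does not vanish at some point. -/
lemma exists_algHom_ne_zero (k A : Type*) [Field k] [IsAlgClosed k] [CommRing A] [IsDomain A]
    [Algebra k A] [Algebra.FiniteType k A] {f : A} (hf : f ≠ 0) : ∃ q : A →ₐ[k] k, q f ≠ 0 := by
  have hp : Submonoid.powers f ≤ nonZeroDivisors A :=
    powers_le_nonZeroDivisors_of_noZeroDivisors hf
  have : IsDomain (Localization.Away f) := IsLocalization.isDomain_of_le_nonZeroDivisors _ hp
  have : Algebra.FiniteType A (Localization.Away f) := IsLocalization.finiteType_of_monoid_fg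
    (Submonoid.powers f) _
  have : Algebra.FiniteType k (Localization.Away f) := .trans ‹Algebra.FiniteType k A› this
  obtain ⟨m, hm⟩ := Ideal.exists_maximal (Localization.Away f)
  let := Ideal.Quotient.field m
  have : Module.Finite k (Localization.Away f ⧸ m) := finite_of_finite_type_of_isJacobsonRing _ _
  let e : k ≃ₐ[k] (Localization.Away f ⧸ m) := AlgEquiv.ofBijective (Algebra.ofId _ _)
    (IsAlgClosed.algebraMap_bijective_of_isIntegral)
  let r : Localization.Away f →ₐ[k] k := e.symm.toAlgHom.comp (Ideal.Quotient.mkₐ k m)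
  refine ⟨r.comp (IsScalarTower.toAlgHom k A (Localization.Away f)), ?_⟩
  exact ((IsLocalization.Away.algebraMap_isUnit f).map r).ne_zero

/-- Factoring an algebra homomorphism through an injective one. -/
lemma AlgHom.exists_comp_eq_of_range_le {k A L M : Type*} [CommRing k] [CommRing A] [CommRing L]
    [CommRing M] [Algebra k A] [Algebra k L] [Algebra k M] (ev : L →ₐ[k] M)
    (hev : Function.Injective ev) (ω : A →ₐ[k] M) (h : ∀ a, ∃ l, ev l = ω a) :
    ∃ ψ : A →ₐ[k] L, ∀ a, ev (ψ a) = ω a := by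
  refine ⟨(AlgEquiv.ofInjective ev hev).symm.toAlgHom.comp (ω.codRestrict ev.range h), fun a => ?_⟩
  exact congrArg Subtype.val ((AlgEquiv.ofInjective ev hev).apply_symm_apply
    (ω.codRestrict ev.range h a))

/-! ### Orbits of locally nilpotent fields -/

section LocallyNilpotent

variable {A : Type*} [CommRing A] [Algebra ℂ A]

open Finset in
lemma Derivation.iterate_apply_mul (D : Derivation ℂ A A) (n : ℕ) (a b : A) :
    D^[n] (a * b) = ∑ ij ∈ antidiagonal n, n.choose ij.1 • (D^[ij.1] a * D^[ij.2] b) := by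
  induction n generalizing a b with
  | zero => simp
  | succ n ih =>
    rw [Function.iterate_succ_apply, leibniz, smul_eq_mul, smul_eq_mul, mul_comm b,
      iterate_map_add D, ih, ih, Finset.sum_antidiagonal_choose_succ_nsmul
        (fun i j => D^[i] a * D^[j] b)]
    simp only [Function.iterate_succ_apply]
    congr 1
    refine sum_congr rfl fun ij hij => ?_
    rw [Nat.choose_symm_of_eq_add (HasAntidiagonal.mem_antidiagonal.mp hij).symm]

/-- The Taylor expansion of a function along the flow of a vector field, at a point `q`. -/
noncomputable def Derivation.taylor (D : Derivation ℂ A A) (q : A →ₐ[ℂ] ℂ) :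
    A →ₐ[ℂ] PowerSeries ℂ where
  toFun a := PowerSeries.mk fun n => q (D^[n] a) / n.factorial
  map_one' := by
    ext n
    rcases n with _ | n
    · simp
    · simp [Function.iterate_succ_apply, iterate_map_zero D, PowerSeries.coeff_one]
  map_mul' a b := by
    ext n
    rw [PowerSeries.coeff_mul]
    simp only [PowerSeries.coeff_mk, D.iterate_apply_mul, map_sum, map_nsmul, map_mul,
      Finset.sum_div]
    refine Finset.sum_congr rfl fun ij hij => ?_
    have hf : ∀ m : ℕ, (m.factorial : ℂ) ≠ 0 := fun m => by exact_mod_cast m.factorial_ne_zero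
    have hn := Finset.HasAntidiagonal.mem_antidiagonal.mp hij
    have h := Nat.add_choose_mul_factorial_mul_factorial ij.1 ij.2
    rw [hn, ← Nat.choose_symm_of_eq_add hn.symm] at h
    have h' : (n.choose ij.1 : ℂ) * ij.1.factorial * ij.2.factorial = n.factorial := by
      exact_mod_cast h
    rw [nsmul_eq_mul, ← h']
    have := hf ij.1
    have := hf ij.2
    have : (n.choose ij.1 : ℂ) ≠ 0 := by
      intro h0
      rw [h0] at h'
      exact hf n (by simpa using h'.symm)
    field_simp
  map_zero' := by
    ext n
    simp [iterate_map_zero D]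
  map_add' a b := by
    ext n
    simp [iterate_map_add D, add_div]
  commutes' c := by
    ext n
    rcases n with _ | n
    · simp
    · simp [Function.iterate_succ_apply, iterate_map_zero D]

@[simp]
lemma Derivation.coeff_taylor (D : Derivation ℂ A A) (q : A →ₐ[ℂ] ℂ) (a : A) (n : ℕ) :
    PowerSeries.coeff n (D.taylor q a) = q (D^[n] a) / n.factorial := by
  simp [taylor]

/-- A locally nilpotent vector field which does not kill `g` has an orbit, parametrized by the
affine line, along which `g` is not constant. -/
lemma AlgVectorField.IsLocallyNilpotent.exists_orbit [IsDomain A] [Algebra.FiniteType ℂ A]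
    {ξ : AlgVectorField A} (hξ : ξ.IsLocallyNilpotent) {g : A} (hg : ξ g ≠ 0) :
    ∃ ψ : A →ₐ[ℂ] ℂ[T;T⁻¹], ∀ c, ψ g ≠ algebraMap ℂ _ c := by
  obtain ⟨q, hq⟩ := exists_algHom_ne_zero ℂ A hg
  obtain ⟨ψ, hψ⟩ := AlgHom.exists_comp_eq_of_range_le (Polynomial.coeToPowerSeries.algHom (R := ℂ) ℂ)
    (by
      intro a b h
      simpa [Polynomial.coeToPowerSeries.algHom_apply] using h) (ξ.taylor q) (by
      intro a
      obtain ⟨N, hN⟩ := hξ a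
      -- Local nilpotency cuts the Taylor series off at `N`, so it is a polynomial.
      refine ⟨(ξ.taylor q a).trunc N, ?_⟩
      ext n
      simp only [Polynomial.coeToPowerSeries.algHom_apply, Algebra.algebraMap_self,
        PowerSeries.map_id, id_eq, Polynomial.coeff_coe, PowerSeries.coeff_trunc,
        Derivation.coeff_taylor]
      split_ifs with h
      · rfl
      · obtain ⟨m, rfl⟩ := Nat.exists_eq_add_of_le' (not_lt.mp h)
        rw [Function.iterate_add_apply, hN, iterate_map_zero ξ, map_zero, zero_div])
  refine ⟨Polynomial.toLaurentAlg.comp ψ, fun c hc => hq ?_⟩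
  have h1 : ψ g = Polynomial.C c := by
    apply Polynomial.toLaurent_injective
    rw [Polynomial.toLaurent_C]
    exact hc
  -- The linear Taylor coefficient of `g` is `q (ξ g)`, nonzero by the choice of `q`.
  have h2 := congrArg (PowerSeries.coeff 1) (hψ g)
  rw [h1] at h2
  simpa [Polynomial.coeToPowerSeries.algHom_apply, Polynomial.coeff_C, PowerSeries.coeff_C] using h2.symm

end LocallyNilpotent

/-! ### Orbits of semi-simple fields -/

section Semisimple

variable {A : Type*} [CommRing A] [Algebra ℂ A]

/-- A Laurent polynomial as a function on the punctured line. -/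
noncomputable def LaurentPolynomial.toFun : ℂ[T;T⁻¹] →ₐ[ℂ] (ℂˣ → ℂ) where
  __ := RingHom.pi fun t : ℂˣ => LaurentPolynomial.eval₂ (RingHom.id ℂ) t
  commutes' c := by
    ext t
    change LaurentPolynomial.eval₂ (RingHom.id ℂ) t (algebraMap ℂ _ c) = _
    rw [← LaurentPolynomial.C_eq_algebraMap, LaurentPolynomial.eval₂_C]
    rfl

lemma LaurentPolynomial.toFun_apply (f : ℂ[T;T⁻¹]) (t : ℂˣ) :
    toFun f t = LaurentPolynomial.eval₂ (RingHom.id ℂ) t f := rfl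

lemma LaurentPolynomial.toFun_injective : Function.Injective toFun := by
  rw [injective_iff_map_eq_zero]
  intro f hf
  obtain ⟨n, P, hP⟩ := f.exists_T_pow
  have hP0 : P = 0 := by
    refine Polynomial.eq_zero_of_infinite_isRoot P (Set.Infinite.mono (s := {0}ᶜ) ?_ ?_)
    · intro z hz
      have h1 := congrArg (fun f => toFun f (Units.mk0 z hz)) hP
      have h0 : eval₂ (RingHom.id ℂ) (Units.mk0 z hz) f = 0 := congrFun hf _
      simp only [map_mul, h0, zero_mul, toFun_apply, eval₂_toLaurent] at h1
      rw [Polynomial.eval₂_id] at h1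
      exact h1
    · exact (Set.finite_singleton _).infinite_compl
  rw [hP0, map_zero] at hP
  exact ((isUnit_T n).mul_left_eq_zero).mp hP.symm

/-- A semisimple vector field which does not kill `g` has an orbit, parametrized by the
punctured line, along which `g` is not constant. -/
lemma AlgVectorField.IsSemisimple.exists_orbit [IsDomain A] [Algebra.FiniteType ℂ A]
    {ξ : AlgVectorField A} (hξ : ξ.IsSemisimple) {g : A} (hg : ξ g ≠ 0) :
    ∃ ψ : A →ₐ[ℂ] ℂ[T;T⁻¹], ∀ c, ψ g ≠ algebraMap ℂ _ c := by
  obtain ⟨q, hq⟩ := exists_algHom_ne_zero ℂ A hg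
  obtain ⟨φ, c, -, hφ⟩ := hξ
  -- Multiplicativity is evident for functions on `ℂˣ`; the Laurent expansions of the action then
  -- factor `ω` through `ℂ[T;T⁻¹]`.
  let ω : A →ₐ[ℂ] (ℂˣ → ℂ) :=
    { RingHom.pi fun t : ℂˣ => (q.comp (φ t).toAlgHom).toRingHom with
      commutes' := fun z => by
        ext t
        exact (q.comp (φ t).toAlgHom).commutes z }
  have hω : ∀ a t, ω a t = q (φ t a) := fun _ _ => rfl
  have key : ∀ (a : A) (p : ℤ →₀ A),
      (∀ t : ℂˣ, φ t a = p.sum fun n a => ((t ^ n : ℂˣ) : ℂ) • a) →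
      LaurentPolynomial.toFun (p.sum fun n a => LaurentPolynomial.C (q a) * LaurentPolynomial.T n)
        = ω a := by
    intro a p hp
    ext t
    rw [hω, hp, LaurentPolynomial.toFun_apply, Finsupp.sum, Finsupp.sum, map_sum, map_sum]
    refine Finset.sum_congr rfl fun n _ => ?_
    rw [LaurentPolynomial.eval₂_C_mul_T, map_smul, smul_eq_mul, mul_comm]
    rfl
  obtain ⟨ψ, hψ⟩ := AlgHom.exists_comp_eq_of_range_le LaurentPolynomial.toFun
    LaurentPolynomial.toFun_injective ω (fun a => ⟨_, key a _ (hφ a).choose_spec.1⟩)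
  refine ⟨ψ, fun z hz => hq ?_⟩
  obtain ⟨p, hp, hv⟩ := hφ g
  have h1 := LaurentPolynomial.toFun_injective ((key g p hp).trans (hψ g).symm)
  rw [hz] at h1
  -- If `g` were constant on the orbit, only weight zero would survive at `q`, and the velocity
  -- ignores weight zero.
  have h2 : ∀ n, n ≠ 0 → q (p n) = 0 := by
    intro n hn
    have h3 := congrArg (fun f => f.coeff n) h1
    simp only [Finsupp.sum, ← LaurentPolynomial.single_eq_C_mul_T,
      ← LaurentPolynomial.C_eq_algebraMap, LaurentPolynomial.C_apply, if_neg hn,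
      AddMonoidAlgebra.coeff_sum, AddMonoidAlgebra.coeff_single, Finsupp.finsetSum_apply,
      Finsupp.single_apply, Finset.sum_ite_eq'] at h3
    by_cases hn' : n ∈ p.support
    · simpa [hn'] using h3
    · simp [Finsupp.notMem_support_iff.mp hn']
  rw [hv, map_smul, Finsupp.sum, map_sum, Finset.sum_eq_zero, smul_zero]
  intro n _
  rw [map_zsmul]
  by_cases hn : n = 0
  · simp [hn]
  · simp [h2 n hn]

end Semisimple

lemma AlgVectorField.exists_orbit {A : Type*} [CommRing A] [Algebra ℂ A] [IsDomain A]
    [Algebra.FiniteType ℂ A] {ξ : AlgVectorField A}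
    (hξ : ξ.IsLocallyNilpotent ∨ ξ.IsSemisimple) {g : A} (hg : ξ g ≠ 0) :
    ∃ ψ : A →ₐ[ℂ] ℂ[T;T⁻¹], ∀ c, ψ g ≠ algebraMap ℂ _ c :=
  hξ.elim (fun h => h.exists_orbit hg) (fun h => h.exists_orbit hg)

/-! ### Units of the Laurent polynomial ring -/

section LaurentPolynomial

namespace LaurentPolynomial

variable {k B : Type*} [Field k] [CommRing B] [Algebra k B]

/-- The evaluation of Laurent polynomials at a unit. -/
noncomputable def aevalUnit (w : Bˣ) : k[T;T⁻¹] →ₐ[k] B where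
  __ := eval₂ (algebraMap k B) w
  commutes' c := by
    change eval₂ (algebraMap k B) w (algebraMap k _ c) = _
    rw [← C_eq_algebraMap, eval₂_C]

lemma aevalUnit_toLaurent (w : Bˣ) (p : k[X]) :
    aevalUnit w (Polynomial.toLaurent p) = Polynomial.aeval (w : B) p :=
  eval₂_toLaurent _ _ p

lemma aevalUnit_T (w : Bˣ) (n : ℤ) : aevalUnit (k := k) w (T n) = (w ^ n : Bˣ) :=
  eval₂_T _ _ n

lemma aevalUnit_injective {w : Bˣ} (hw : Transcendental k (w : B)) :
    Function.Injective (aevalUnit (k := k) w) := by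
  rw [injective_iff_map_eq_zero]
  intro f hf
  obtain ⟨n, P, hP⟩ := f.exists_T_pow
  have h := congrArg (aevalUnit w) hP
  rw [aevalUnit_toLaurent, map_mul, hf, zero_mul] at h
  rw [transcendental_iff.mp hw P h, map_zero] at hP
  exact ((isUnit_T n).mul_left_eq_zero).mp hP.symm

/-- Clearing denominators in `x * y = 1` leaves a factorization of a power of the prime `X`. -/
lemma exists_eq_C_mul_T_of_isUnit {x : k[T;T⁻¹]} (hx : IsUnit x) :
    ∃ (a : k) (n : ℤ), x = C a * T n := by
  obtain ⟨y, hxy⟩ := hx.exists_right_inv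
  obtain ⟨n, P, hP⟩ := x.exists_T_pow
  obtain ⟨m, Q, hQ⟩ := y.exists_T_pow
  have h : P * Q = Polynomial.X ^ (n + m) := by
    apply Polynomial.toLaurent_injective
    rw [map_mul, hP, hQ, Polynomial.toLaurent_X_pow, Nat.cast_add, T_add, mul_mul_mul_comm, hxy,
      one_mul]
  obtain ⟨i, -, hi⟩ := (dvd_prime_pow Polynomial.prime_X _).mp (Dvd.intro _ h)
  obtain ⟨v, hv⟩ := hi.symm
  obtain ⟨a, -, ha⟩ := Polynomial.isUnit_iff.mp v.isUnit
  rw [← ha] at hv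
  refine ⟨a, i - n, ?_⟩
  rw [sub_eq_add_neg, T_add, ← mul_assoc, ← Polynomial.toLaurent_X_pow, ← Polynomial.toLaurent_C,
    ← map_mul, mul_comm, mul_comm (Polynomial.C a), hv, hP, mul_comm, mul_assoc, ← T_add,
    add_neg_cancel, T_zero, mul_one]

/-- Two units differing by a nonzero constant are monomials, which must both have degree zero.
Geometrically, a map from the punctured line to the line missing two points is constant. -/
lemma eq_algebraMap_of_isUnit_of_isUnit {x : k[T;T⁻¹]} {d e : k} (hde : d ≠ e)
    (hd : IsUnit (x - algebraMap k _ d)) (he : IsUnit (x - algebraMap k _ e)) :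
    ∃ c, x = algebraMap k _ c := by
  obtain ⟨a, n, hn⟩ := exists_eq_C_mul_T_of_isUnit hd
  obtain ⟨b, m, hm⟩ := exists_eq_C_mul_T_of_isUnit he
  by_cases hn0 : n = 0
  · refine ⟨a + d, ?_⟩
    rw [hn0, T_zero, mul_one, C_eq_algebraMap] at hn
    rw [map_add, ← hn, sub_add_cancel]
  · exfalso
    have h : C a * T n + C (d - e) = C b * T m := by
      rw [← hn, ← hm, map_sub, C_eq_algebraMap, C_eq_algebraMap]
      ring
    rw [← single_eq_C_mul_T, ← single_eq_C_mul_T] at h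
    have h0 := congrArg (fun f => f.coeff 0) h
    have h1 := congrArg (fun f => f.coeff n) h
    simp only [AddMonoidAlgebra.coeff_add, Finsupp.add_apply, C_apply,
      AddMonoidAlgebra.coeff_single, Finsupp.single_apply, hn0, if_false, if_true, zero_add,
      add_zero] at h0 h1
    have hm0 : m = 0 := by
      by_contra hm0
      rw [if_neg hm0] at h0
      exact hde (sub_eq_zero.mp h0)
    rw [if_neg (by rw [hm0]; exact Ne.symm hn0)] at h1
    rw [h1, map_zero, zero_mul] at hn
    exact not_isUnit_zero (hn ▸ hd)

end LaurentPolynomial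

end LaurentPolynomial

/-! ### Normal curves dominated by the punctured line -/

section Curve

open IntermediateField

variable {k K F : Type*} [Field k] [CommRing K] [IsDomain K] [Algebra k K] [Field F] [Algebra k F]
  [Algebra K F] [IsScalarTower k K F]

lemma exists_isCoprime_mul_aeval_eq {u : F} (hu : k⟮u⟯ = ⊤) (x : F) :
    ∃ r s : k[X], IsCoprime r s ∧ Polynomial.aeval u s ≠ 0 ∧
      x * Polynomial.aeval u s = Polynomial.aeval u r := by
  classical
  obtain ⟨r, s, rfl⟩ := (mem_adjoin_simple_iff k x).mp (hu ▸ mem_top)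
  by_cases hs : Polynomial.aeval u s = 0
  -- Division by zero makes `x = 0` here.
  · exact ⟨0, 1, isCoprime_zero_left.mpr isUnit_one, by simp, by simp [hs]⟩
  obtain ⟨r', s', hr, hs', hc⟩ : ∃ r' s', r = gcd r s * r' ∧ s = gcd r s * s' ∧ IsCoprime r' s' := by
    obtain ⟨r', s', hr, hs', h⟩ := extract_gcd r s
    exact ⟨r', s', hr, hs', (gcd_isUnit_iff _ _).mp h⟩
  have h := hs
  rw [hs', map_mul] at h
  refine ⟨r', s', hc, right_ne_zero_of_mul h, ?_⟩
  have hg := left_ne_zero_of_mul h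
  have h1 := right_ne_zero_of_mul h
  have hr' : Polynomial.aeval u r = Polynomial.aeval u (gcd r s) * Polynomial.aeval u r' := by
    rw [← map_mul, ← hr]
  have hs'' : Polynomial.aeval u s = Polynomial.aeval u (gcd r s) * Polynomial.aeval u s' := by
    rw [← map_mul, ← hs']
  rw [hr', hs'']
  field_simp

lemma Polynomial.isIntegral_of_isUnit_leadingCoeff {R S : Type*} [CommRing R] [CommRing S]
    [Algebra R S] {p : R[X]} (hp : IsUnit p.leadingCoeff) {x : S} (hx : aeval x p = 0) :
    IsIntegral R x := by
  obtain ⟨v, hv⟩ := hp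
  refine ⟨C (↑v⁻¹ : R) * p, ?_, ?_⟩
  · rw [Monic, leadingCoeff_C_mul_of_isUnit v⁻¹.isUnit, ← hv, Units.inv_mul]
  · rw [eval₂_mul, ← aeval_def x p, hx, mul_zero]

lemma Polynomial.isIntegral_inv_of_isUnit_coeff_zero {R S : Type*} [CommRing R] [Nontrivial R]
    [Field S] [Algebra R S] {p : R[X]} (hp : IsUnit (p.coeff 0)) {x : S} (hx0 : x ≠ 0)
    (hx : aeval x p = 0) : IsIntegral R x⁻¹ := by
  have hd : p.natTrailingDegree = 0 := natTrailingDegree_eq_zero.mpr (Or.inr hp.ne_zero)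
  refine isIntegral_of_isUnit_leadingCoeff (p := p.reverse) ?_ ?_
  · rw [reverse_leadingCoeff, trailingCoeff, hd]
    exact hp
  · let := invertibleOfNonzero hx0
    rw [← invOf_eq_inv, aeval_def, eval₂_reverse_eq_zero_iff]
    exact hx

/-- If the fraction field of an integrally closed domain `K` is a purely transcendental extension
of transcendence degree one, then it has a generator inside `K`. -/
lemma exists_generator_mem [IsAlgClosed k] [IsIntegrallyClosed K] [IsFractionRing K F] {u₀ : F}
    (hu₀ : k⟮u₀⟯ = ⊤) {f : K} (hf : ∀ c, f ≠ algebraMap k K c) :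
    ∃ u : K, k⟮algebraMap K F u⟯ = ⊤ := by
  have hinj : Function.Injective (algebraMap K F) := IsFractionRing.injective K F
  have hf' : ∀ c, algebraMap K F f ≠ algebraMap k F c := fun c hc => hf c
    (hinj (by rw [hc, IsScalarTower.algebraMap_apply k K F]))
  obtain ⟨r, s, hrs, hs0, h⟩ := exists_isCoprime_mul_aeval_eq hu₀ (algebraMap K F f)
  suffices H : ∃ v : F, IsIntegral K v ∧ k⟮v⟯ = ⊤ by
    obtain ⟨v, hv, hv'⟩ := H
    obtain ⟨u, rfl⟩ := (isIntegrallyClosed_iff F).mp ‹_› hv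
    exact ⟨u, hv'⟩
  -- From `f = r(u₀) / s(u₀)`, `u₀` is a root of `r - f * s` over `K`. For constant `s` its leading
  -- coefficient is a unit, so `u₀` is integral. Otherwise, at a root `d` of `s` its value is the
  -- unit `r(d)`, so `(u₀ - d)⁻¹` is integral.
  have hroot : Polynomial.aeval u₀ ((r.map (algebraMap k K)) -
      Polynomial.C f * (s.map (algebraMap k K))) = 0 := by
    rw [map_sub, map_mul, Polynomial.aeval_map_algebraMap, Polynomial.aeval_map_algebraMap,
      Polynomial.aeval_C, h, sub_self]
  by_cases hs : s.degree = 0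
  · obtain ⟨c, hc⟩ : ∃ c, s = Polynomial.C c := ⟨_, Polynomial.eq_C_of_degree_le_zero hs.le⟩
    subst hc
    rw [Polynomial.aeval_C] at h hs0
    have hc0 : c ≠ 0 := fun h0 => hs0 (by rw [h0, map_zero])
    have hr : 0 < r.natDegree := by
      by_contra hr
      rw [Polynomial.eq_C_of_natDegree_eq_zero (Nat.eq_zero_of_not_pos hr),
        Polynomial.aeval_C] at h
      refine hf' (r.coeff 0 / c) ?_
      rw [map_div₀, eq_div_iff hs0, h]
    refine ⟨u₀, Polynomial.isIntegral_of_isUnit_leadingCoeff ?_ hroot, hu₀⟩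
    rw [Polynomial.map_C, ← Polynomial.C_mul, Polynomial.leadingCoeff_sub_of_degree_lt,
      Polynomial.leadingCoeff_map]
    · exact (IsUnit.mk0 _ (Polynomial.leadingCoeff_ne_zero.mpr
        (Polynomial.ne_zero_of_natDegree_gt hr))).map _
    · refine Polynomial.degree_C_le.trans_lt ?_
      rw [Polynomial.degree_map, ← Polynomial.natDegree_pos_iff_degree_pos]
      exact hr
  · obtain ⟨d, hd⟩ := IsAlgClosed.exists_root s hs
    have hrd : r.eval d ≠ 0 := by
      intro hr
      obtain ⟨a, b, hab⟩ := hrs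
      have := congrArg (Polynomial.eval d) hab
      rw [Polynomial.eval_add, Polynomial.eval_mul, Polynomial.eval_mul, hr, hd.eq_zero] at this
      simp at this
    have hud : u₀ - algebraMap k F d ≠ 0 := by
      intro h0
      rw [sub_eq_zero.mp h0, Polynomial.aeval_algebraMap_apply] at hs0
      rw [Polynomial.coe_aeval_eq_eval, hd.eq_zero, map_zero] at hs0
      exact hs0 rfl
    refine ⟨(u₀ - algebraMap k F d)⁻¹, Polynomial.isIntegral_inv_of_isUnit_coeff_zero
      (p := ((r.map (algebraMap k K)) - Polynomial.C f * (s.map (algebraMap k K))).comp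
        (Polynomial.X + Polynomial.C (algebraMap k K d))) ?_ hud ?_, ?_⟩
    · rw [Polynomial.coeff_zero_eq_eval_zero, Polynomial.eval_comp]
      simp only [Polynomial.eval_add, Polynomial.eval_X, Polynomial.eval_C, zero_add,
        Polynomial.eval_sub, Polynomial.eval_mul, Polynomial.eval_map_algebraMap,
        Polynomial.aeval_algebraMap_apply, Polynomial.coe_aeval_eq_eval, hd.eq_zero, map_zero,
        mul_zero, sub_zero]
      exact (IsUnit.mk0 _ hrd).map _
    · rw [Polynomial.aeval_comp]
      simp only [map_add, Polynomial.aeval_X, Polynomial.aeval_C,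
        ← IsScalarTower.algebraMap_apply, sub_add_cancel]
      exact hroot
    · rw [eq_top_iff, ← hu₀, adjoin_simple_le_iff]
      have h1 := inv_mem (mem_adjoin_simple_self k (u₀ - algebraMap k F d)⁻¹)
      rw [inv_inv] at h1
      simpa using add_mem h1 (IntermediateField.algebraMap_mem k⟮(u₀ - algebraMap k F d)⁻¹⟯ d)

lemma exists_eq_algebraMap_of_isAlgebraic [IsAlgClosed k] {u : K} (hu : IsAlgebraic k u) :
    ∃ c, u = algebraMap k K c := by
  have hi := hu.isIntegral
  obtain ⟨c, hc⟩ := minpoly.mem_range_of_degree_eq_one k u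
    (IsAlgClosed.degree_eq_one_of_irreducible k (minpoly.irreducible hi))
  exact ⟨c, hc.symm⟩

/-- A domain whose fraction field is generated over `k` by a nonconstant element `u` of the domain,
such that `u - d` is a unit for at most one constant `d`, is the coordinate ring of the line or of
the punctured line. -/
lemma nonempty_algEquiv_of_generator [IsAlgClosed k] [IsFractionRing K F] {u : K}
    (hu : k⟮algebraMap K F u⟯ = ⊤) {f : K} (hf : ∀ c, f ≠ algebraMap k K c)
    (hunit : ∀ d e : k, IsUnit (u - algebraMap k K d) → IsUnit (u - algebraMap k K e) → d = e) :
    Nonempty (K ≃ₐ[k] k[X]) ∨ Nonempty (K ≃ₐ[k] k[T;T⁻¹]) := by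
  have hinj : Function.Injective (algebraMap K F) := IsFractionRing.injective K F
  have hut : Transcendental k u := by
    intro halg
    obtain ⟨c, rfl⟩ := exists_eq_algebraMap_of_isAlgebraic halg
    rw [← IsScalarTower.algebraMap_apply, adjoin_simple_eq_bot_iff.mpr (IntermediateField.algebraMap_mem _ _)] at hu
    obtain ⟨c', hc'⟩ := mem_bot.mp (hu ▸ mem_top : algebraMap K F f ∈ (⊥ : IntermediateField k F))
    refine hf c' (hinj ?_)
    rw [← hc', IsScalarTower.algebraMap_apply k K F]
  have hrep : ∀ x : K, ∃ r s : k[X], IsUnit (Polynomial.aeval u s) ∧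
      x * Polynomial.aeval u s = Polynomial.aeval u r := by
    intro x
    obtain ⟨r, s, ⟨a, b, hab⟩, -, h⟩ := exists_isCoprime_mul_aeval_eq hu (algebraMap K F x)
    rw [Polynomial.aeval_algebraMap_apply, Polynomial.aeval_algebraMap_apply, ← map_mul] at h
    have h' := hinj h
    -- Bézout `a r + b s = 1` with `r(u) = x s(u)` exhibits the inverse of `s(u)`.
    refine ⟨r, s, .of_mul_eq_one (Polynomial.aeval u a * x + Polynomial.aeval u b) ?_, h'⟩
    have := congrArg (Polynomial.aeval u) hab
    rw [map_add, map_mul, map_mul, map_one, ← h'] at this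
    rw [← this]
    ring
  have hfac : ∀ s : k[X], IsUnit (Polynomial.aeval u s) → ∀ d, s.IsRoot d →
      IsUnit (u - algebraMap k K d) := by
    intro s hs d hd
    obtain ⟨q, rfl⟩ := Polynomial.dvd_iff_isRoot.mpr hd
    rw [map_mul, map_sub, Polynomial.aeval_X, Polynomial.aeval_C] at hs
    exact isUnit_of_mul_isUnit_left hs
  by_cases hd : ∃ d, IsUnit (u - algebraMap k K d)
  · right
    obtain ⟨d, w, hw⟩ := hd
    have hwt : Transcendental k (w : K) := by
      rw [hw]
      intro halg
      apply hut
      simpa using halg.add (isAlgebraic_algebraMap d)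
    refine ⟨(AlgEquiv.ofBijective (LaurentPolynomial.aevalUnit w)
      ⟨LaurentPolynomial.aevalUnit_injective hwt, ?_⟩).symm⟩
    have hpoly : ∀ p : k[X], Polynomial.aeval u p ∈
        (LaurentPolynomial.aevalUnit (k := k) w).range := by
      intro p
      refine ⟨Polynomial.toLaurent (p.comp (Polynomial.X + Polynomial.C d)), ?_⟩
      change LaurentPolynomial.aevalUnit w _ = _
      rw [LaurentPolynomial.aevalUnit_toLaurent, Polynomial.aeval_comp]
      simp [hw]
    intro x
    change x ∈ (LaurentPolynomial.aevalUnit (k := k) w).range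
    obtain ⟨r, s, hs, h⟩ := hrep x
    have hs0 : s ≠ 0 := by
      rintro rfl
      rw [map_zero] at hs
      exact not_isUnit_zero hs
    -- Each root of a denominator makes `u` minus that root a unit, so `d` is the only root.
    have hsp : s = Polynomial.C s.leadingCoeff * (Polynomial.X - Polynomial.C d) ^ s.natDegree := by
      have hsplit := IsAlgClosed.splits s
      have hroots : s.roots = Multiset.replicate s.natDegree d := by
        rw [Multiset.eq_replicate]
        refine ⟨hsplit.natDegree_eq_card_roots.symm, fun e he => ?_⟩
        exact hunit _ _ (hfac s hs e (Polynomial.isRoot_of_mem_roots he)) ⟨w, hw⟩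
      conv_lhs => rw [hsplit.eq_prod_roots, hroots]
      simp
    have hinv : ((w⁻¹ : Kˣ) : K) ∈ (LaurentPolynomial.aevalUnit (k := k) w).range :=
      ⟨LaurentPolynomial.T (-1), by
        change LaurentPolynomial.aevalUnit w _ = _
        rw [LaurentPolynomial.aevalUnit_T, zpow_neg_one]⟩
    have hx : x = Polynomial.aeval u r * algebraMap k K s.leadingCoeff⁻¹ *
        ((w⁻¹ : Kˣ) : K) ^ s.natDegree := by
      have h1 : Polynomial.aeval u s = algebraMap k K s.leadingCoeff * (w : K) ^ s.natDegree := by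
        conv_lhs => rw [hsp]
        simp [hw]
      have h2 : algebraMap k K s.leadingCoeff * algebraMap k K s.leadingCoeff⁻¹ = 1 := by
        rw [← map_mul, mul_inv_cancel₀ (Polynomial.leadingCoeff_ne_zero.mpr hs0), map_one]
      have h3 : (w : K) ^ s.natDegree * ((w⁻¹ : Kˣ) : K) ^ s.natDegree = 1 := by
        rw [← mul_pow, Units.mul_inv, one_pow]
      rw [← h, h1]
      linear_combination
        (-(x * ((w : K) ^ s.natDegree * ((w⁻¹ : Kˣ) : K) ^ s.natDegree))) * h2 - x * h3
    rw [hx]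
    exact mul_mem (mul_mem (hpoly r) (Subalgebra.algebraMap_mem _ _)) (pow_mem hinv _)
  · left
    refine ⟨(AlgEquiv.ofBijective (Polynomial.aeval u)
      ⟨transcendental_iff_injective.mp hut, fun x => ?_⟩).symm⟩
    obtain ⟨r, s, hs, h⟩ := hrep x
    have hs0 : s.degree = 0 := by
      by_contra h0
      obtain ⟨d, hd'⟩ := IsAlgClosed.exists_root s h0
      exact hd ⟨d, hfac s hs d hd'⟩
    rw [Polynomial.eq_C_of_degree_le_zero hs0.le, Polynomial.aeval_C] at h
    have hc : s.coeff 0 ≠ 0 := by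
      intro h0
      rw [Polynomial.eq_C_of_degree_le_zero hs0.le, h0, map_zero, Polynomial.degree_zero] at hs0
      exact absurd hs0 (by simp)
    refine ⟨r * Polynomial.C (s.coeff 0)⁻¹, ?_⟩
    rw [map_mul, ← h, Polynomial.aeval_C, mul_assoc, ← map_mul, mul_inv_cancel₀ hc, map_one,
      mul_one]

/-- An integrally closed domain which embeds nontrivially into the Laurent polynomials over
an algebraically closed field is isomorphic to the polynomials or the Laurent polynomials. -/
theorem nonempty_algEquiv_polynomial_or_laurentPolynomial [IsAlgClosed k] [IsIntegrallyClosed K]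
    (ψ : K →ₐ[k] k[T;T⁻¹]) (hψ : Function.Injective ψ) {f : K}
    (hf : ∀ c, ψ f ≠ algebraMap k _ c) :
    Nonempty (K ≃ₐ[k] k[X]) ∨ Nonempty (K ≃ₐ[k] k[T;T⁻¹]) := by
  let j : k[T;T⁻¹] →ₐ[k] RatFunc k :=
    LaurentPolynomial.aevalUnit (Units.mk0 RatFunc.X RatFunc.X_ne_zero)
  have hj : Function.Injective j := LaurentPolynomial.aevalUnit_injective RatFunc.transcendental_X
  let Φ : FractionRing K →ₐ[k] RatFunc k :=
    IsFractionRing.liftAlgHom (g := j.comp ψ) (hj.comp hψ)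
  have hfc : ∀ c, f ≠ algebraMap k K c := by
    rintro c rfl
    exact hf c (ψ.commutes c)
  -- Lüroth applies to the image of `Frac K` in `k(X)`; its generator is pulled back along `Φ`.
  obtain ⟨u₀, hu₀⟩ : RatFunc.Luroth.generator Φ.fieldRange ∈ Φ.fieldRange := by
    have := mem_adjoin_simple_self k (RatFunc.Luroth.generator Φ.fieldRange)
    rwa [← RatFunc.Luroth.eq_adjoin_generator] at this
  have htop : k⟮u₀⟯ = ⊤ := by
    apply IntermediateField.map_injective Φ
    rw [adjoin_map, Set.image_singleton, ← AlgHom.fieldRange_eq_map]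
    conv_rhs => rw [RatFunc.Luroth.eq_adjoin_generator (E := Φ.fieldRange), ← hu₀]
    rfl
  obtain ⟨u, hu⟩ := exists_generator_mem htop hfc
  refine nonempty_algEquiv_of_generator hu hfc fun d e hd he => ?_
  by_contra hde
  have hd' := hd.map ψ
  have he' := he.map ψ
  rw [map_sub, ψ.commutes] at hd' he'
  obtain ⟨c, hc⟩ := LaurentPolynomial.eq_algebraMap_of_isUnit_of_isUnit hde hd' he'
  rw [← ψ.commutes] at hc
  rw [hψ hc, ← IsScalarTower.algebraMap_apply,
    adjoin_simple_eq_bot_iff.mpr (IntermediateField.algebraMap_mem _ _)] at hu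
  obtain ⟨c', hc'⟩ := mem_bot.mp
    (hu ▸ mem_top : algebraMap K (FractionRing K) f ∈ (⊥ : IntermediateField k (FractionRing K)))
  refine hfc c' (IsFractionRing.injective K (FractionRing K) ?_)
  rw [← hc', IsScalarTower.algebraMap_apply k K (FractionRing K)]

end Curve

/-! ### Tensor products and the comparison map -/

section Tensor

variable {k A : Type*} [Field k] [CommRing A] [Algebra k A]

lemma Algebra.Smooth.polynomial : Algebra.Smooth k k[X] :=
  { formallySmooth := inferInstance
    finitePresentation := .equiv (MvPolynomial.uniqueAlgEquiv k Unit) }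

lemma Algebra.Smooth.laurentPolynomial : Algebra.Smooth k k[T;T⁻¹] := by
  have : IsScalarTower k k[X] k[T;T⁻¹] := .of_algebraMap_eq fun c => by
    rw [Polynomial.algebraMap_eq, LaurentPolynomial.algebraMap_eq_toLaurent,
      Polynomial.toLaurent_C, LaurentPolynomial.C_eq_algebraMap]
  have : Algebra.Smooth k k[X] := .polynomial
  have : Algebra.Smooth k[X] k[T;T⁻¹] := .of_isLocalization_Away (Polynomial.X : k[X])
  exact .comp k k[X] k[T;T⁻¹]

lemma Algebra.Smooth.tensorProduct (P Q : Type*) [CommRing P] [CommRing Q] [Algebra k P]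
    [Algebra k Q] [Algebra.Smooth k P] [Algebra.Smooth k Q] : Algebra.Smooth k (P ⊗[k] Q) :=
  .comp k P (P ⊗[k] Q)

-- Identifying `K ⊗ k[X]` with `K[X]` turns the product map into evaluation at `ψ X`.
open Algebra.TensorProduct in
lemma productMap_polynomial_injective (K : Subalgebra k A) (ψ : k[X] →ₐ[k] A)
    (h : Transcendental K (ψ Polynomial.X)) : Function.Injective (productMap K.val ψ) := by
  have key : ∀ p : K[X], productMap K.val ψ (polyEquivTensor k K p) =
      Polynomial.aeval (ψ Polynomial.X) p := by
    intro p
    induction p using Polynomial.induction_on' with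
    | add p q hp hq => rw [map_add, map_add, map_add, hp, hq]
    | monomial n a =>
      rw [polyEquivTensor_apply, ← Polynomial.C_mul_X_pow_eq_monomial]
      simp
  rw [injective_iff_map_eq_zero]
  intro z hz
  obtain ⟨p, rfl⟩ := (polyEquivTensor k K).surjective z
  rw [key] at hz
  rw [transcendental_iff.mp h p hz, map_zero]

open Algebra.TensorProduct in
lemma exists_mul_eq_map_toLaurent (K : Type*) [CommRing K] [Algebra k K] (z : K ⊗[k] k[T;T⁻¹]) :
    ∃ N : ℕ, ∃ w, z * (1 ⊗ₜ LaurentPolynomial.T N) =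
      map (AlgHom.id k K) (Polynomial.toLaurentAlg (R := k)) w := by
  induction z with
  | zero => exact ⟨0, 0, by simp⟩
  | tmul a f =>
    obtain ⟨n, P, hP⟩ := f.exists_T_pow
    refine ⟨n, a ⊗ₜ P, ?_⟩
    simp [hP]
  | add x y hx hy =>
    obtain ⟨n, u, hu⟩ := hx
    obtain ⟨m, v, hv⟩ := hy
    have hT : ∀ m : ℕ, (1 ⊗ₜ LaurentPolynomial.T m : K ⊗[k] k[T;T⁻¹]) =
        map (AlgHom.id k K) (Polynomial.toLaurentAlg (R := k)) (1 ⊗ₜ Polynomial.X ^ m) := by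
      intro m
      simp
    refine ⟨n + m, u * (1 ⊗ₜ Polynomial.X ^ m) + v * (1 ⊗ₜ Polynomial.X ^ n), ?_⟩
    rw [map_add, map_mul, map_mul, ← hT, ← hT, ← hu, ← hv, Nat.cast_add, LaurentPolynomial.T_add,
      ← one_mul (1 : K), ← tmul_mul_tmul, one_mul]
    ring

-- Multiplying by a power of the unit `1 ⊗ T` reduces injectivity to the polynomial case.
open Algebra.TensorProduct in
lemma productMap_laurentPolynomial_injective (K : Subalgebra k A) (ψ : k[T;T⁻¹] →ₐ[k] A)
    (h : Transcendental K (ψ (LaurentPolynomial.T 1))) :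
    Function.Injective (productMap K.val ψ) := by
  rw [injective_iff_map_eq_zero]
  intro z hz
  obtain ⟨N, w, hw⟩ := exists_mul_eq_map_toLaurent K z
  have h1 : productMap K.val (ψ.comp Polynomial.toLaurentAlg) w = 0 := by
    have : productMap K.val (ψ.comp Polynomial.toLaurentAlg) =
        (productMap K.val ψ).comp (map (AlgHom.id k K) (Polynomial.toLaurentAlg (R := k))) := by
      ext <;> simp
    rw [this, AlgHom.comp_apply, ← hw, map_mul, hz, zero_mul]
  have h2 := (injective_iff_map_eq_zero _).mp (productMap_polynomial_injective K
    (ψ.comp Polynomial.toLaurentAlg) (by simpa using h)) w h1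
  rw [h2, map_zero] at hw
  have hu : IsUnit (1 ⊗ₜ LaurentPolynomial.T N : K ⊗[k] k[T;T⁻¹]) :=
    (LaurentPolynomial.isUnit_T N).map (includeRight : k[T;T⁻¹] →ₐ[k] K ⊗[k] k[T;T⁻¹])
  exact hu.mul_left_eq_zero.mp hw

/-- An injective map from a smooth algebra onto a subring of a domain which contains a nonzero
ideal is surjective. -/
lemma AlgHom.surjective_of_smooth_of_mul_mem_range {R : Type*} [CommRing R] [Algebra k R]
    [Algebra.Smooth k R] [IsDomain A] (Φ : R →ₐ[k] A) (hΦ : Function.Injective Φ) {h : A}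
    (h0 : h ≠ 0) (hh : ∀ a, h * a ∈ Φ.range) : Function.Surjective Φ := by
  have hdom : IsDomain R := hΦ.isDomain Φ.toRingHom
  have hnormal : IsIntegrallyClosed R := .of_smooth k R
  have hnoeth : IsNoetherianRing R := Algebra.FiniteType.isNoetherianRing k R
  algebraize [Φ.toRingHom]
  have hΦ' : Function.Injective (algebraMap R A) := hΦ
  have hfaith : FaithfulSMul R A := (faithfulSMul_iff_algebraMap_injective R A).mpr hΦ'
  let e := LinearEquiv.ofInjective (Algebra.linearMap R A) hΦ'
  -- Multiplication by `h` embeds `A` into `R` as a module, so `A` is Noetherian over `R`, hence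
  -- integral.
  let m : A →ₗ[R] R := e.symm.toLinearMap.comp
    ((LinearMap.mulLeft R h).codRestrict (LinearMap.range (Algebra.linearMap R A)) hh)
  have hm : Function.Injective m := by
    refine e.symm.injective.comp fun a b hab => ?_
    exact mul_left_cancel₀ h0 (congrArg Subtype.val hab)
  have hN : IsNoetherian R A := isNoetherian_of_injective m hm
  intro a
  have hint : IsIntegral R a := Algebra.IsIntegral.isIntegral a
  -- With `b` and `c` the preimages of `h` and `h * a`, `a` is the fraction `c / b` of `R`;
  -- normality of `R` finishes.
  obtain ⟨b, hb⟩ := hh 1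
  obtain ⟨c, hc⟩ := hh a
  change Φ b = _ at hb
  change Φ c = _ at hc
  rw [mul_one] at hb
  have hb0 : b ≠ 0 := by
    rintro rfl
    exact h0 (by rw [← hb, map_zero])
  let φ : FractionRing R →ₐ[R] FractionRing A :=
    IsFractionRing.liftAlgHom (g := Algebra.ofId R (FractionRing A))
      (FaithfulSMul.algebraMap_injective _ _)
  have hφ : φ (algebraMap R _ c / algebraMap R _ b) = algebraMap A _ a := by
    rw [map_div₀, φ.commutes, φ.commutes, IsScalarTower.algebraMap_apply R A,
      IsScalarTower.algebraMap_apply R A _ b]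
    change algebraMap A _ (Φ c) / algebraMap A _ (Φ b) = _
    rw [hb, hc, map_mul, mul_div_cancel_left₀]
    exact (map_ne_zero_iff _ (IsFractionRing.injective A (FractionRing A))).mpr h0
  have hint' : IsIntegral R (algebraMap R (FractionRing R) c / algebraMap R _ b) := by
    rw [← isIntegral_algHom_iff φ φ.toRingHom.injective, hφ]
    exact hint.algebraMap
  obtain ⟨r, hr⟩ := (isIntegrallyClosed_iff (FractionRing R)).mp hnormal hint'
  refine ⟨r, IsFractionRing.injective A (FractionRing A) ?_⟩
  rw [← hφ, ← hr, φ.commutes, IsScalarTower.algebraMap_apply R A]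
  rfl

lemma nonempty_polynomial_tensor_polynomial_algEquiv :
    Nonempty ((k[X] ⊗[k] k[X]) ≃ₐ[k] MvPolynomial (Fin 2) k) :=
  ⟨((Algebra.TensorProduct.congr (MvPolynomial.uniqueAlgEquiv k Unit)
    (MvPolynomial.uniqueAlgEquiv k Unit)).symm.trans
      ((MvPolynomial.tensorEquivSum k Unit Unit k).restrictScalars k)).trans
        (MvPolynomial.renameEquiv k (Fintype.equivOfCardEq (by simp)))⟩

end Tensor

/-! ### Kernels of a semi-compatible pair -/

section Kernels

variable {A : Type*} [CommRing A] [Algebra ℂ A] [IsDomain A]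

/-- If one vector field kills the kernel of the other, the pair is not semi-compatible. -/
lemma AlgVectorField.exists_apply_ne_zero_of_ideal_le_kerSpan {ξ η : AlgVectorField A} (hξ : ξ ≠ 0)
    {h : A} (h0 : h ≠ 0) (hh : ∀ a, h * a ∈ kerSpan ξ η) : ∃ g, η g = 0 ∧ ξ g ≠ 0 := by
  by_contra! H
  have hle : ∀ a ∈ kerSpan ξ η, ξ a = 0 := by
    intro a ha
    induction ha using Submodule.span_induction with
    | mem x hx =>
      obtain ⟨f, g, hf, hg, rfl⟩ := hx
      simp [hf, H g hg]
    | zero => simp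
    | add x y _ _ hx hy => simp [hx, hy]
    | smul c x _ hx => simp [hx]
  have h1 : ξ h = 0 := by simpa using hle _ (hh 1)
  refine hξ (Derivation.ext fun a => ?_)
  have h2 := hle _ (hh a)
  rw [Derivation.leibniz, h1, smul_zero, add_zero, smul_eq_mul] at h2
  simpa [h0] using h2

lemma AlgVectorField.kerSpan_comm {A : Type*} [CommRing A] [Algebra ℂ A] (ξ η : AlgVectorField A) :
    kerSpan ξ η = kerSpan η ξ := by
  unfold kerSpan
  congr 1
  ext h
  constructor
  · rintro ⟨f, g, hf, hg, rfl⟩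
    exact ⟨g, f, hg, hf, mul_comm _ _⟩
  · rintro ⟨f, g, hf, hg, rfl⟩
    exact ⟨g, f, hg, hf, mul_comm _ _⟩

/-- The kernel of a vector field on a normal affine surface, if it contains a function which is not
constant along the flow of a locally nilpotent or semisimple vector field, is the coordinate ring
of the line or of the punctured line. -/
lemma AlgVectorField.nonempty_kerSubalgebra_algEquiv [Algebra.FiniteType ℂ A] [IsIntegrallyClosed A]
    (hA : ringKrullDim A ≤ 2) {ξ η : AlgVectorField A}
    (hξ : ξ.IsLocallyNilpotent ∨ ξ.IsSemisimple) (hη : η ≠ 0) {g : A} (hg : η g = 0)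
    (hg' : ξ g ≠ 0) :
    Nonempty (Derivation.kerSubalgebra η ≃ₐ[ℂ] ℂ[X]) ∨
      Nonempty (Derivation.kerSubalgebra η ≃ₐ[ℂ] ℂ[T;T⁻¹]) := by
  obtain ⟨ψ, hψ⟩ := exists_orbit hξ hg'
  have := Derivation.isIntegrallyClosed_kerSubalgebra η
  have hgt : Transcendental ℂ g := by
    intro halg
    obtain ⟨c, rfl⟩ := exists_eq_algebraMap_of_isAlgebraic halg
    exact hψ c (ψ.commutes c)
  refine nonempty_algEquiv_polynomial_or_laurentPolynomial
    (ψ.comp (Derivation.kerSubalgebra η).val) ?_ (f := ⟨g, hg⟩) hψ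
  rw [injective_iff_map_eq_zero]
  rintro ⟨f, hf⟩ hfψ
  change ψ f = 0 at hfψ
  by_contra hf0
  have hf0' : f ≠ 0 := fun h => hf0 (Subtype.ext h)
  -- A relation for `f` over `ℂ[g]` can be taken with nonzero constant term `P(g)`. If `ψ f = 0`,
  -- then `P(ψ g) = 0`, so `ψ g` is algebraic over `ℂ` and therefore constant.
  obtain ⟨q, hq0, hq⟩ := (Derivation.isAlgebraic_adjoin_of_mem_kerSubalgebra hA hη hf hg
    hgt).exists_nonzero_coeff_and_aeval_eq_zero (mem_nonZeroDivisors_of_ne_zero hf0')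
  have h1 : ψ (q.coeff 0) = 0 := by
    have h2 := congrArg ψ hq
    rw [← Polynomial.divX_mul_X_add q, map_add, map_mul, Polynomial.aeval_X, Polynomial.aeval_C,
      map_add, map_mul, hfψ, mul_zero, zero_add, map_zero] at h2
    exact h2
  obtain ⟨P, hP⟩ : ∃ P : ℂ[X], Polynomial.aeval g P = (q.coeff 0 : A) := by
    exact (Algebra.adjoin_singleton_eq_range_aeval ℂ g).le (q.coeff 0).2
  have hP0 : P ≠ 0 := by
    rintro rfl
    rw [map_zero] at hP
    exact hq0 (Subtype.ext hP.symm)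
  have h3 : IsAlgebraic ℂ (ψ g) := ⟨P, hP0, by rw [Polynomial.aeval_algHom_apply, hP, h1]⟩
  obtain ⟨c, hc⟩ := exists_eq_algebraMap_of_isAlgebraic h3
  exact hψ c hc

end Kernels

/-! ### Product decomposition and conclusion -/

section Product

variable {k A : Type*} [Field k] [CommRing A] [Algebra k A]

/-- By the chain rule, a derivation that moves some function on the line moves its coordinate; this
yields the transcendental generator for the tensor product. -/
lemma Derivation.apply_X_ne_zero (D : Derivation k A A) (ψ : k[X] →ₐ[k] A) {f : k[X]}
    (hf : D (ψ f) ≠ 0) : D (ψ Polynomial.X) ≠ 0 := by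
  intro h
  apply hf
  rw [← Polynomial.aeval_X_left_apply f, ← Polynomial.aeval_algHom_apply, D.map_aeval, h, smul_zero]

lemma Derivation.apply_T_ne_zero (D : Derivation k A A) (ψ : k[T;T⁻¹] →ₐ[k] A) {f : k[T;T⁻¹]}
    (hf : D (ψ f) ≠ 0) : D (ψ (LaurentPolynomial.T 1)) ≠ 0 := by
  intro h
  obtain ⟨n, P, hP⟩ := f.exists_T_pow
  have h1 : D (ψ (LaurentPolynomial.T n)) = 0 := by
    rw [← mul_one (n : ℤ), ← LaurentPolynomial.T_pow, map_pow, D.leibniz_pow, h, smul_zero,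
      smul_zero]
  have h2 : D (ψ (f * LaurentPolynomial.T n)) = 0 := by
    by_contra h2
    rw [← hP] at h2
    have h3 := D.apply_X_ne_zero (ψ.comp Polynomial.toLaurentAlg) h2
    rw [AlgHom.comp_apply, Polynomial.toLaurentAlg_apply, Polynomial.toLaurent_X] at h3
    exact h3 h
  rw [map_mul, D.leibniz, h1, smul_zero, zero_add, smul_eq_mul] at h2
  exact hf ((((LaurentPolynomial.isUnit_T n).map ψ).mul_right_eq_zero).mp h2)

/-- Let `K` be the kernel of a derivation of a domain and `L` a subalgebra which is linearly disjoint
from `K`, both of them smooth. If the product of `K` and `L` contains a nonzero ideal of the domain,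
then the domain is the tensor product of `K` and `L`. -/
lemma Derivation.exists_algEquiv_tensorProduct [IsDomain A] (D : Derivation k A A)
    {P Q : Type*} [CommRing P] [CommRing Q] [Algebra k P] [Algebra k Q] [Algebra.Smooth k P] [Algebra.Smooth k Q]
    (e : D.kerSubalgebra ≃ₐ[k] P) {L : Subalgebra k A} (e' : L ≃ₐ[k] Q)
    (hinj : Function.Injective
      (Algebra.TensorProduct.productMap D.kerSubalgebra.val (L.val.comp e'.symm.toAlgHom)))
    {h : A} (h0 : h ≠ 0)
    (hh : ∀ a, h * a ∈ Submodule.span k {x | ∃ f g : A, D f = 0 ∧ g ∈ L ∧ x = f * g}) :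
    Nonempty (A ≃ₐ[k] P ⊗[k] Q) := by
  let ε := Algebra.TensorProduct.congr e.symm (AlgEquiv.refl (R := k) (A₁ := Q))
  let Φ := (Algebra.TensorProduct.productMap D.kerSubalgebra.val
    (L.val.comp e'.symm.toAlgHom)).comp ε.toAlgHom
  have : Algebra.Smooth k (P ⊗[k] Q) := .tensorProduct P Q
  have hΦ : Function.Injective Φ := hinj.comp ε.injective
  refine ⟨(AlgEquiv.ofBijective Φ ⟨hΦ, Φ.surjective_of_smooth_of_mul_mem_range hΦ h0
    fun a => ?_⟩).symm⟩
  have hle : Submodule.span k {x | ∃ f g : A, D f = 0 ∧ g ∈ L ∧ x = f * g} ≤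
      Subalgebra.toSubmodule Φ.range := by
    rw [Submodule.span_le]
    rintro _ ⟨f, g, hf, hg, rfl⟩
    refine ⟨e ⟨f, hf⟩ ⊗ₜ e' ⟨g, hg⟩, ?_⟩
    simp [Φ, ε]
  exact hle (hh a)

end Product

theorem mainTheorem11 (A : Type*) [CommRing A] [Algebra ℂ A]
    (hA : IsSmoothAffineSurface A)
    -- the surface is not isomorphic to ℂ², ℂ* × ℂ* or ℂ* × ℂ
    (h₁ : IsEmpty (A ≃ₐ[ℂ] MvPolynomial (Fin 2) ℂ))
    (h₂ : IsEmpty (A ≃ₐ[ℂ] (ℂ[T;T⁻¹] ⊗[ℂ] ℂ[T;T⁻¹])))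
    (h₃ : IsEmpty (A ≃ₐ[ℂ] (ℂ[T;T⁻¹] ⊗[ℂ] ℂ[X]))) :
    ¬ ∃ ξ η : AlgVectorField A,
      (ξ.IsLocallyNilpotent ∨ ξ.IsSemisimple) ∧
      (η.IsLocallyNilpotent ∨ η.IsSemisimple) ∧
      AlgVectorField.IsSemiCompatible ξ η := by
  rintro ⟨ξ, η, hξ, hη, hξ0, hη0, I, hI, hIle⟩
  have := hA.isDomain
  have := hA.smooth
  have : IsIntegrallyClosed A := .of_smooth ℂ A
  have hdim : ringKrullDim A ≤ 2 := hA.dim_eq_two.le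
  obtain ⟨h, hhI, h0⟩ := Submodule.exists_mem_ne_zero_of_ne_bot hI
  have hh : ∀ a, h * a ∈ AlgVectorField.kerSpan ξ η := fun a => hIle (I.mul_mem_right a hhI)
  obtain ⟨g, hg, hg'⟩ := AlgVectorField.exists_apply_ne_zero_of_ideal_le_kerSpan hξ0 h0 hh
  obtain ⟨f, hf, hf'⟩ := AlgVectorField.exists_apply_ne_zero_of_ideal_le_kerSpan hη0 h0
    (fun a => AlgVectorField.kerSpan_comm ξ η ▸ hh a)
  have : Algebra.Smooth ℂ ℂ[X] := .polynomial
  have : Algebra.Smooth ℂ ℂ[T;T⁻¹] := .laurentPolynomial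
  have hX : ∀ e' : Derivation.kerSubalgebra η ≃ₐ[ℂ] ℂ[X], Function.Injective
      (Algebra.TensorProduct.productMap (Derivation.kerSubalgebra ξ).val
        ((Derivation.kerSubalgebra η).val.comp e'.symm.toAlgHom)) := fun e' =>
    productMap_polynomial_injective _ _ (ξ.transcendental_kerSubalgebra
      (ξ.apply_X_ne_zero _ (f := e' ⟨g, hg⟩) (by simpa using hg')))
  have hT : ∀ e' : Derivation.kerSubalgebra η ≃ₐ[ℂ] ℂ[T;T⁻¹], Function.Injective
      (Algebra.TensorProduct.productMap (Derivation.kerSubalgebra ξ).val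
        ((Derivation.kerSubalgebra η).val.comp e'.symm.toAlgHom)) := fun e' =>
    productMap_laurentPolynomial_injective _ _ (ξ.transcendental_kerSubalgebra
      (ξ.apply_T_ne_zero _ (f := e' ⟨g, hg⟩) (by simpa using hg')))
  -- The roles cross: orbits of `η` determine `Ker ξ`, and orbits of `ξ` determine `Ker η`.
  rcases AlgVectorField.nonempty_kerSubalgebra_algEquiv hdim hη hξ0 hf hf' with ⟨⟨e⟩⟩ | ⟨⟨e⟩⟩ <;>
  rcases AlgVectorField.nonempty_kerSubalgebra_algEquiv hdim hξ hη0 hg hg' with ⟨⟨e'⟩⟩ | ⟨⟨e'⟩⟩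
  · obtain ⟨i⟩ := ξ.exists_algEquiv_tensorProduct e e' (hX e') h0 hh
    obtain ⟨j⟩ := nonempty_polynomial_tensor_polynomial_algEquiv (k := ℂ)
    exact h₁.false (i.trans j)
  · obtain ⟨i⟩ := ξ.exists_algEquiv_tensorProduct e e' (hT e') h0 hh
    exact h₃.false (i.trans (Algebra.TensorProduct.comm ℂ _ _))
  · obtain ⟨i⟩ := ξ.exists_algEquiv_tensorProduct e e' (hX e') h0 hh
    exact h₃.false i
  · obtain ⟨i⟩ := ξ.exists_algEquiv_tensorProduct e e' (hT e') h0 hh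
    exact h₂.false i
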